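/- Fix $n\in\mathbb N$, $I=\{1,\dots,n\}$, real numbers $a_J\ge 0$ ($J\subseteq I$) with $a_\emptyset=0$ and $\sum_{J\subseteq I}a_J=1$, and real numbers $\gamma_i>0$ ($i\in I$) with $\sum_{i\in I}\gamma_i=1$. For $A\subseteq I$ put $\mathcal P_A=\{J\subseteq A: a_J>0\}$, $\mathcal P=\mathcal P_I$ and $\gamma(A)=\sum_{i\in A}\gamma_i$. For each $N\in\mathbb N$ and $i\in I$ let $\Sigma_N^i$ be a finite set with $|\Sigma_N^i|\ge 1$ and $\frac1N\log_2|\Sigma_N^i|\to\gamma_i$ as $N\to\infty$. Let $\Sigma_N=\prod_{i\in I}\Sigma_N^i$, and for $\sigma\in\Sigma_N$, $J\subseteq I$, write $\sigma_J=(\sigma_j)_{j\in J}$. For each $N$ let $X^J_{\tau}$ ($J\in\mathcal P$, $\tau\in\prod_{j\in J}\Sigma_N^j$) be independent centered Gaussian random variables, $X^J_\tau$ having variance $a_JN$, and set $X_\sigma=\sum_{J\in\mathcal P}X^J_{\sigma_J}$, $F_N(\beta)=\frac1N\log\Big(\frac1{|\Sigma_N|}\sum_{\sigma\in\Sigma_N}e^{\beta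 X_\sigma}\Big)$, $f_N(\beta)=\mathbb E\,F_N(\beta)$. Proposition 4. For every $\beta\ge 0$, $F_N(\beta)$ is integrable for every $N$, the limit $f(\beta)=\lim_{N\to\infty}f_N(\beta)$ exists in $\mathbb R$, and $f(\beta)=\sup_{\lambda\in\Delta^+}\ \sum_{J\in\mathcal P}\Big(\beta\lambda_J-\frac{\lambda_J^2}{2a_J}\Big)$, where $\Delta^+$ is the set of all $\lambda\in\mathbb R^{\mathcal P}$ with $\lambda_J\ge 0$ for all $J\in\mathcal P$ and $\sum_{J\in\mathcal P_A}\frac{\lambda_J^2}{2a_J}\le\gamma(A)\log 2$ for every $A\subseteq I$. -/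

import Mathlib

open MeasureTheory ProbabilityTheory Filter Topology

noncomputable section

namespace NonhierGREM

/-- `𝒫_A`: the subsets `J ⊆ A` with `a_J > 0`. -/
def activeSets {n : ℕ} (a : Finset (Fin n) → ℝ) (A : Finset (Fin n)) :
    Finset (Finset (Fin n)) :=
  A.powerset.filter (fun J => 0 < a J)

/-- The index type `𝒫 = 𝒫_I`. -/
abbrev Active {n : ℕ} (a : Finset (Fin n) → ℝ) : Type :=
  {J : Finset (Fin n) // J ∈ activeSets a Finset.univ}

/-- `Σ_{N,J}`: the partial configurations `(σ_j)_{j ∈ J}`, where the `j`-th spin takes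
`m j` values. -/
abbrev LocalConfig {n : ℕ} (m : Fin n → ℕ) (J : Finset (Fin n)) : Type :=
  (j : J) → Fin (m j)

/-- `Σ_N`: the configurations `σ = (σ_1, …, σ_n)`. -/
abbrev Config {n : ℕ} (m : Fin n → ℕ) : Type :=
  (i : Fin n) → Fin (m i)

/-- The projected configuration `σ_J`. -/
def Config.proj {n : ℕ} {m : Fin n → ℕ} (σ : Config m) (J : Finset (Fin n)) :
    LocalConfig m J :=
  fun j => σ j

/-- The variables `X^J_τ`, `J ∈ 𝒫`, `τ ∈ Σ_{N,J}`, are independent centered Gaussians, and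
`X^J_τ` has variance `a_J N`. -/
structure IsDisorder {n : ℕ} (a : Finset (Fin n) → ℝ) (N : ℕ) (m : Fin n → ℕ)
    {Ω : Type*} [MeasurableSpace Ω] (μ : Measure Ω)
    (X : (J : Active a) → LocalConfig m J.1 → Ω → ℝ) : Prop where
  hasLaw : ∀ (J : Active a) (τ : LocalConfig m J.1),
    HasLaw (X J τ) (gaussianReal 0 (Real.toNNReal (a J.1 * N))) μ
  indep : iIndepFun (fun p : (Σ J : Active a, LocalConfig m J.1) => X p.1 p.2) μ

/-- The Hamiltonian `X_σ = ∑_{J ∈ 𝒫} X^J_{σ_J}`. -/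
def hamiltonian {n : ℕ} {a : Finset (Fin n) → ℝ} {m : Fin n → ℕ} {Ω : Type*}
    (X : (J : Active a) → LocalConfig m J.1 → Ω → ℝ) (ω : Ω) (σ : Config m) : ℝ :=
  ∑ J : Active a, X J (σ.proj J.1) ω

/-- `Z_N(β, x) = tr exp(β x)`, where `tr` is the average over all configurations. -/
def partitionFunction {n : ℕ} {m : Fin n → ℕ} (β : ℝ) (x : Config m → ℝ) : ℝ :=
  (∑ σ : Config m, Real.exp (β * x σ)) / (Fintype.card (Config m) : ℝ)

/-- `F_N(β, x) = N⁻¹ log Z_N(β, x)`. -/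
def finiteFreeEnergy {n : ℕ} {m : Fin n → ℕ} (N : ℕ) (β : ℝ) (x : Config m → ℝ) : ℝ :=
  (1 / (N : ℝ)) * Real.log (partitionFunction β x)

/-- `Δ⁺`: the nonnegative `l ∈ ℝ^𝒫` with `∑_{J ∈ 𝒫_A} l_J² / (2 a_J) ≤ γ(A) log 2` for all
`A ⊆ I`. -/
def deltaPlus {n : ℕ} (a : Finset (Fin n) → ℝ) (γ : Fin n → ℝ) : Set (Active a → ℝ) :=
  {l | (∀ J, 0 ≤ l J) ∧
    ∀ A : Finset (Fin n),
      ∑ J : Active a with J.1 ∈ activeSets a A, l J ^ 2 / (2 * a J.1)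
        ≤ (∑ i ∈ A, γ i) * Real.log 2}

/-- `ψ(l, β) = ∑_{J ∈ 𝒫} (β l_J - l_J² / (2 a_J))`. -/
def psi {n : ℕ} (a : Finset (Fin n) → ℝ) (β : ℝ) (l : Active a → ℝ) : ℝ :=
  ∑ J : Active a, (β * l J - l J ^ 2 / (2 * a J.1))

end NonhierGREM

end

open NonhierGREM

open scoped NNReal

namespace NonhierGREM

/-! ### Gaussian estimates -/

lemma gaussianPDFReal_mul_exp_sq {v : ℝ≥0} (hv : v ≠ 0) (t x : ℝ) :
    gaussianPDFReal 0 v x * Real.exp (t * (x ^ 2 / (2 * v))) =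
      (√(2 * Real.pi * v))⁻¹ * Real.exp (-((1 - t) / (2 * v)) * x ^ 2) := by
  have hv' : (v : ℝ) ≠ 0 := by exact_mod_cast hv
  rw [gaussianPDFReal, mul_assoc, ← Real.exp_add]
  congr 2
  field_simp
  ring

lemma integrable_exp_sq_gaussianReal {v : ℝ≥0} (hv : v ≠ 0) {t : ℝ} (ht : t < 1) :
    Integrable (fun x => Real.exp (t * (x ^ 2 / (2 * v)))) (gaussianReal 0 v) := by
  have hv' : (0 : ℝ) < v := by exact_mod_cast pos_iff_ne_zero.2 hv
  rw [gaussianReal_of_var_ne_zero _ hv,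
    integrable_withDensity_iff_integrable_smul' (measurable_gaussianPDF _ _)
      (ae_of_all _ fun _ => gaussianPDF_lt_top)]
  simp only [toReal_gaussianPDF, smul_eq_mul, gaussianPDFReal_mul_exp_sq hv]
  exact (integrable_exp_neg_mul_sq (div_pos (by linarith) (by positivity))).const_mul _

lemma integral_exp_sq_gaussianReal {v : ℝ≥0} (hv : v ≠ 0) {t : ℝ} (ht : t < 1) :
    ∫ x, Real.exp (t * (x ^ 2 / (2 * v))) ∂(gaussianReal 0 v) = (√(1 - t))⁻¹ := by
  have hv' : (0 : ℝ) < v := by exact_mod_cast pos_iff_ne_zero.2 hv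
  have ht' : 0 < 1 - t := by linarith
  rw [integral_gaussianReal_eq_integral_smul hv]
  simp only [smul_eq_mul, gaussianPDFReal_mul_exp_sq hv]
  rw [integral_const_mul, integral_gaussian, ← Real.sqrt_inv, ← Real.sqrt_inv,
    ← Real.sqrt_mul (by positivity)]
  congr 1
  have := Real.pi_pos
  field_simp

lemma gaussianReal_Ici_lower_bound {v : ℝ≥0} (hv : v ≠ 0) {x h : ℝ} (hx : 0 ≤ x) (hh : 0 ≤ h) :
    h * ((√(2 * Real.pi * v))⁻¹ * Real.exp (-(x + h) ^ 2 / (2 * v))) ≤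
      (gaussianReal 0 v).real (Set.Ici x) := by
  have hle : (gaussianReal 0 v).real (Set.Icc x (x + h)) ≤ (gaussianReal 0 v).real (Set.Ici x) :=
    measureReal_mono Set.Icc_subset_Ici_self
  refine le_trans ?_ hle
  rw [measureReal_def, gaussianReal_apply_eq_integral 0 hv, ENNReal.toReal_ofReal
    (integral_nonneg fun y => gaussianPDFReal_nonneg _ _ _)]
  have hc : ∫ _ in Set.Icc x (x + h), ((√(2 * Real.pi * v))⁻¹ *
      Real.exp (-(x + h) ^ 2 / (2 * v))) =
      h * ((√(2 * Real.pi * v))⁻¹ * Real.exp (-(x + h) ^ 2 / (2 * v))) := by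
    simp [hh]
  rw [← hc]
  refine setIntegral_mono_on (integrableOn_const (by simp)) (integrable_gaussianPDFReal 0 v).integrableOn
    measurableSet_Icc fun y hy => ?_
  rw [gaussianPDFReal, sub_zero]
  have : y ^ 2 ≤ (x + h) ^ 2 := pow_le_pow_left₀ (hx.trans hy.1) hy.2 2
  gcongr

/-- Large deviation lower bound for the tail of a centered Gaussian of variance `s * N`. -/
lemma eventually_exp_le_gaussianReal_Ici {s l δ : ℝ} (hs : 0 < s) (hl : 0 ≤ l) (hδ : 0 < δ) :
    ∀ᶠ N : ℕ in atTop, Real.exp (-(N * (l ^ 2 / (2 * s) + δ))) ≤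
      (gaussianReal 0 (Real.toNNReal (s * N))).real (Set.Ici (l * N)) := by
  obtain ⟨η, hη, hη'⟩ : ∃ η : ℝ, 0 < η ∧ (l + η) ^ 2 / (2 * s) ≤ l ^ 2 / (2 * s) + δ := by
    have hc : Tendsto (fun η : ℝ => (l + η) ^ 2 / (2 * s)) (𝓝[>] 0) (𝓝 ((l + 0) ^ 2 / (2 * s))) :=
      (Continuous.tendsto (by fun_prop) 0).mono_left nhdsWithin_le_nhds
    rw [add_zero] at hc
    obtain ⟨η, h1, h2⟩ := ((hc.eventually (eventually_le_nhds
      (lt_add_of_pos_right _ hδ))).and self_mem_nhdsWithin).exists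
    exact ⟨η, h2, h1⟩
  have hN : ∀ᶠ N : ℕ in atTop, 2 * Real.pi * s / η ^ 2 ≤ (N : ℝ) :=
    tendsto_natCast_atTop_atTop.eventually_ge_atTop _
  filter_upwards [hN, eventually_gt_atTop 0] with N hN hN0
  have hN0' : (0 : ℝ) < N := by exact_mod_cast hN0
  have hv : Real.toNNReal (s * N) ≠ 0 := by simpa using mul_pos hs hN0'
  have hcoe : ((Real.toNNReal (s * N) : ℝ≥0) : ℝ) = s * N := Real.coe_toNNReal _ (by positivity)
  refine le_trans ?_ (gaussianReal_Ici_lower_bound hv (x := l * N) (h := η * N)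
    (by positivity) (by positivity))
  rw [hcoe, ← mul_assoc]
  have h1 : 1 ≤ η * N * (√(2 * Real.pi * (s * N)))⁻¹ := by
    have hp := Real.pi_pos
    rw [← div_eq_mul_inv, one_le_div (by positivity), Real.sqrt_le_left (by positivity)]
    rw [div_le_iff₀ (by positivity)] at hN
    nlinarith
  have h2 : Real.exp (-(N * (l ^ 2 / (2 * s) + δ))) ≤
      Real.exp (-(l * N + η * N) ^ 2 / (2 * (s * N))) := by
    apply Real.exp_le_exp.2
    have : -(l * N + η * N) ^ 2 / (2 * (s * N)) = -(N * ((l + η) ^ 2 / (2 * s))) := by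
      field_simp
    rw [this]
    gcongr
  calc _ ≤ _ := h2
    _ ≤ _ := le_mul_of_one_le_left (Real.exp_pos _).le h1

/-! ### The disorder -/

variable {n : ℕ} {a : Finset (Fin n) → ℝ} {N : ℕ} {m : Fin n → ℕ}
  {Ω : Type*} [MeasurableSpace Ω] {μ : Measure Ω}
  {X : (J : Active a) → LocalConfig m J.1 → Ω → ℝ}

lemma Active.pos (J : Active a) : 0 < a J.1 := (Finset.mem_filter.1 J.2).2

lemma mem_activeSets_iff {J : Active a} {A : Finset (Fin n)} :
    J.1 ∈ activeSets a A ↔ J.1 ⊆ A := by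
  simp [activeSets, J.pos]

/-- `∑_{J ∈ 𝒫_A} (X^J_{σ_J})² / (2 a_J N)`. -/
noncomputable def quadEnergy (N : ℕ) (X : (J : Active a) → LocalConfig m J.1 → Ω → ℝ)
    (A : Finset (Fin n)) (σ : Config m) (ω : Ω) : ℝ :=
  ∑ J : Active a with J.1 ∈ activeSets a A, (X J (σ.proj J.1) ω) ^ 2 / (2 * (a J.1 * N))

lemma IsDisorder.toNNReal_ne_zero (hN : 0 < N) (J : Active a) :
    Real.toNNReal (a J.1 * N) ≠ 0 := by
  have : 0 < a J.1 * N := mul_pos J.pos (by exact_mod_cast hN)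
  simpa using this

lemma IsDisorder.indep_proj (hX : IsDisorder a N m μ X) (σ : Config m) :
    iIndepFun (fun J : Active a => X J (σ.proj J.1)) μ :=
  hX.indep.precomp (g := fun J : Active a => (⟨J, σ.proj J.1⟩ : Σ J : Active a, LocalConfig m J.1))
    (fun _ _ h => congrArg Sigma.fst h)

lemma IsDisorder.integrable_exp_sq (hX : IsDisorder a N m μ X) (hN : 0 < N) {t : ℝ} (ht : t < 1)
    (J : Active a) (τ : LocalConfig m J.1) :
    Integrable (fun ω => Real.exp (t * ((X J τ ω) ^ 2 / (2 * (a J.1 * N))))) μ := by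
  have h := integrable_exp_sq_gaussianReal (IsDisorder.toNNReal_ne_zero hN J) ht
  rw [Real.coe_toNNReal _ (mul_nonneg J.pos.le N.cast_nonneg), ← (hX.hasLaw J τ).map_eq] at h
  exact h.comp_aemeasurable (hX.hasLaw J τ).aemeasurable

lemma IsDisorder.integral_exp_sq (hX : IsDisorder a N m μ X) (hN : 0 < N) {t : ℝ} (ht : t < 1)
    (J : Active a) (τ : LocalConfig m J.1) :
    ∫ ω, Real.exp (t * ((X J τ ω) ^ 2 / (2 * (a J.1 * N)))) ∂μ = (√(1 - t))⁻¹ := by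
  have h := integral_exp_sq_gaussianReal (IsDisorder.toNNReal_ne_zero hN J) ht
  rw [Real.coe_toNNReal _ (mul_nonneg J.pos.le N.cast_nonneg), ← (hX.hasLaw J τ).map_eq,
    integral_map (hX.hasLaw J τ).aemeasurable
      (Continuous.aestronglyMeasurable (by fun_prop))] at h
  exact h

lemma IsDisorder.integrable_exp_quadEnergy [IsProbabilityMeasure μ] (hX : IsDisorder a N m μ X)
    (hmeas : ∀ J τ, Measurable (X J τ)) (hN : 0 < N) {t : ℝ} (ht : t < 1)
    (A : Finset (Fin n)) (σ : Config m) :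
    Integrable (fun ω => Real.exp (t * quadEnergy N X A σ ω)) μ := by
  have hind := (hX.indep_proj σ).comp (fun (J : Active a) (x : ℝ) => x ^ 2 / (2 * (a J.1 * N)))
    (fun J => by fun_prop)
  have h := hind.integrable_exp_mul_sum (t := t) (s := {J : Active a | J.1 ∈ activeSets a A})
    (fun J => by have := hmeas J (σ.proj J.1); fun_prop)
    (fun J _ => hX.integrable_exp_sq hN ht J (σ.proj J.1))
  simpa [quadEnergy, Finset.sum_apply] using h

lemma IsDisorder.integral_exp_quadEnergy_le [IsProbabilityMeasure μ] (hX : IsDisorder a N m μ X)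
    (hmeas : ∀ J τ, Measurable (X J τ)) (hN : 0 < N) {t : ℝ} (ht0 : 0 ≤ t) (ht : t < 1)
    (A : Finset (Fin n)) (σ : Config m) :
    ∫ ω, Real.exp (t * quadEnergy N X A σ ω) ∂μ ≤ (√(1 - t))⁻¹ ^ Fintype.card (Active a) := by
  have hind := (hX.indep_proj σ).comp (fun (J : Active a) (x : ℝ) => x ^ 2 / (2 * (a J.1 * N)))
    (fun J => by fun_prop)
  have h := hind.mgf_sum (t := t)
    (fun J => by have := hmeas J (σ.proj J.1); fun_prop) {J : Active a | J.1 ∈ activeSets a A}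
  have h2 : ∀ J : Active a, mgf ((fun x : ℝ => x ^ 2 / (2 * (a J.1 * N))) ∘ X J (σ.proj J.1)) μ t
      = (√(1 - t))⁻¹ := fun J => hX.integral_exp_sq hN ht J _
  simp only [h2, Finset.prod_const] at h
  have h3 : ∫ ω, Real.exp (t * quadEnergy N X A σ ω) ∂μ =
      mgf (∑ J : Active a with J.1 ∈ activeSets a A,
        (fun x : ℝ => x ^ 2 / (2 * (a J.1 * N))) ∘ X J (σ.proj J.1)) μ t := by
    simp [mgf, quadEnergy, Finset.sum_apply]
  rw [h3, h]
  refine pow_le_pow_right₀ ?_ (Finset.card_le_univ _)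
  rw [one_le_inv₀ (Real.sqrt_pos.2 (by linarith))]
  exact Real.sqrt_le_one.2 (by linarith)

/-! ### The free energy -/

lemma hamiltonian_measurable (hmeas : ∀ J τ, Measurable (X J τ)) (σ : Config m) :
    Measurable (fun ω => hamiltonian X ω σ) :=
  Finset.measurable_sum _ fun J _ => hmeas J _

lemma partitionFunction_pos (hm : ∀ i, 0 < m i) (β : ℝ) (x : Config m → ℝ) :
    0 < partitionFunction β x := by
  have : Nonempty (Config m) := ⟨fun i => ⟨0, hm i⟩⟩
  unfold partitionFunction
  have : 0 < ∑ σ : Config m, Real.exp (β * x σ) :=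
    Finset.sum_pos (fun _ _ => Real.exp_pos _) Finset.univ_nonempty
  have : 0 < Fintype.card (Config m) := Fintype.card_pos
  positivity

/-- Jensen's inequality. -/
lemma mean_le_log_partitionFunction (hm : ∀ i, 0 < m i) (β : ℝ) (x : Config m → ℝ) :
    (∑ σ, β * x σ) / (Fintype.card (Config m) : ℝ) ≤ Real.log (partitionFunction β x) := by
  have : Nonempty (Config m) := ⟨fun i => ⟨0, hm i⟩⟩
  have hc : (0 : ℝ) < Fintype.card (Config m) := by exact_mod_cast Fintype.card_pos
  rw [Real.le_log_iff_exp_le (partitionFunction_pos hm β x)]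
  have h := convexOn_exp.map_sum_le (t := Finset.univ)
    (w := fun _ : Config m => (Fintype.card (Config m) : ℝ)⁻¹) (p := fun σ => β * x σ)
    (fun _ _ => by positivity)
    (by rw [Finset.sum_const, Finset.card_univ, nsmul_eq_mul, mul_inv_cancel₀ hc.ne']) (fun _ _ => Set.mem_univ _)
  simp only [smul_eq_mul, ← Finset.mul_sum] at h
  rw [partitionFunction, div_eq_inv_mul, div_eq_inv_mul]
  simpa only [Finset.mul_sum] using h

lemma log_partitionFunction_le (hm : ∀ i, 0 < m i) (β : ℝ) (x : Config m → ℝ) {c : ℝ}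
    {w : Config m → ℝ} (h : ∀ σ, β * x σ ≤ c + w σ) :
    Real.log (partitionFunction β x) ≤
      c + (∑ σ, Real.exp (w σ)) / (Fintype.card (Config m) : ℝ) := by
  set W := (∑ σ, Real.exp (w σ)) / (Fintype.card (Config m) : ℝ) with hW
  have hle : partitionFunction β x ≤ Real.exp c * W := by
    rw [hW, ← mul_div_assoc, Finset.mul_sum, partitionFunction]
    gcongr with σ
    rw [← Real.exp_add]
    exact Real.exp_le_exp.2 (h σ)
  have hpos := partitionFunction_pos hm β x
  have hWpos : 0 < W := pos_of_mul_pos_right (hpos.trans_le hle) (Real.exp_pos _).le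
  calc _ ≤ Real.log (Real.exp c * W) := Real.log_le_log hpos hle
    _ = c + Real.log W := by rw [Real.log_mul (Real.exp_pos _).ne' hWpos.ne', Real.log_exp]
    _ ≤ c + W := by have := Real.log_le_sub_one_of_pos hWpos; linarith

lemma IsDisorder.memLp_two (hX : IsDisorder a N m μ X) (J : Active a) (τ : LocalConfig m J.1) :
    MemLp (X J τ) 2 μ := by
  have h := memLp_id_gaussianReal (μ := 0) (v := Real.toNNReal (a J.1 * N)) 2
  rw [← (hX.hasLaw J τ).map_eq] at h
  exact h.comp_of_map (hX.hasLaw J τ).aemeasurable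

lemma IsDisorder.integral_sq (hX : IsDisorder a N m μ X) (J : Active a) (τ : LocalConfig m J.1) :
    ∫ ω, (X J τ ω) ^ 2 ∂μ = a J.1 * N := by
  have h := variance_fun_id_gaussianReal (μ := 0) (v := Real.toNNReal (a J.1 * N))
  rw [variance_of_integral_eq_zero (by fun_prop) integral_id_gaussianReal,
    Real.coe_toNNReal _ (mul_nonneg J.pos.le N.cast_nonneg), ← (hX.hasLaw J τ).map_eq,
    integral_map (hX.hasLaw J τ).aemeasurable
      (Continuous.aestronglyMeasurable (by fun_prop))] at h
  exact h

lemma IsDisorder.integrable [IsProbabilityMeasure μ] (hX : IsDisorder a N m μ X) (J : Active a)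
    (τ : LocalConfig m J.1) : Integrable (X J τ) μ :=
  (hX.memLp_two J τ).integrable (by norm_num)

lemma measurable_log_partitionFunction (hmeas : ∀ J τ, Measurable (X J τ)) (β : ℝ) :
    Measurable (fun ω => Real.log (partitionFunction β (hamiltonian X ω))) := by
  unfold partitionFunction
  have := hamiltonian_measurable hmeas
  fun_prop

lemma abs_log_partitionFunction_le (hm : ∀ i, 0 < m i) (β : ℝ) (x : Config m → ℝ) {b : ℝ}
    (h : ∀ σ, |β * x σ| ≤ b) : |Real.log (partitionFunction β x)| ≤ b := by
  have : Nonempty (Config m) := ⟨fun i => ⟨0, hm i⟩⟩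
  have hc : (0 : ℝ) < Fintype.card (Config m) := by exact_mod_cast Fintype.card_pos
  have hpos := partitionFunction_pos hm β x
  rw [abs_le]
  constructor
  · refine le_trans ?_ (mean_le_log_partitionFunction hm β x)
    rw [le_div_iff₀ hc]
    calc -b * (Fintype.card (Config m) : ℝ) = ∑ _ : Config m, -b := by simp [mul_comm]
      _ ≤ _ := Finset.sum_le_sum fun σ _ => (abs_le.1 (h σ)).1
  · rw [Real.log_le_iff_le_exp hpos, partitionFunction, div_le_iff₀ hc]
    calc ∑ σ, Real.exp (β * x σ) ≤ ∑ _ : Config m, Real.exp b :=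
          Finset.sum_le_sum fun σ _ => Real.exp_le_exp.2 (abs_le.1 (h σ)).2
      _ = _ := by simp [mul_comm]

lemma IsDisorder.integrable_log_partitionFunction [IsProbabilityMeasure μ]
    (hX : IsDisorder a N m μ X) (hm : ∀ i, 0 < m i) (hmeas : ∀ J τ, Measurable (X J τ)) (β : ℝ) :
    Integrable (fun ω => Real.log (partitionFunction β (hamiltonian X ω))) μ := by
  have hint : Integrable (fun ω => ∑ σ : Config m, |β| * ∑ J : Active a, |X J (σ.proj J.1) ω|) μ :=
    integrable_finsetSum _ fun σ _ => (integrable_finsetSum _ fun J _ =>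
      (hX.integrable J _).abs).const_mul _
  refine hint.mono' (measurable_log_partitionFunction hmeas β).aestronglyMeasurable
    (ae_of_all _ fun ω => ?_)
  rw [Real.norm_eq_abs]
  refine abs_log_partitionFunction_le hm β _ fun σ => ?_
  rw [abs_mul]
  calc |β| * |hamiltonian X ω σ| ≤ |β| * ∑ J : Active a, |X J (σ.proj J.1) ω| := by
        gcongr; exact Finset.abs_sum_le_sum_abs _ _
    _ ≤ _ := Finset.single_le_sum
        (f := fun σ : Config m => |β| * ∑ J : Active a, |X J (σ.proj J.1) ω|)
        (fun σ _ => by positivity) (Finset.mem_univ σ)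

end NonhierGREM

namespace NonhierGREM

variable {n : ℕ} {a : Finset (Fin n) → ℝ} {N : ℕ} {m : Fin n → ℕ}
  {Ω : Type*} [MeasurableSpace Ω] {μ : Measure Ω}
  {X : (J : Active a) → LocalConfig m J.1 → Ω → ℝ}

/-! ### The upper bound -/

lemma zero_mem_deltaPlus {γ : Fin n → ℝ} (hγ : ∀ i, 0 < γ i) : (0 : Active a → ℝ) ∈ deltaPlus a γ :=
  ⟨fun _ => le_rfl, fun A => by
    simpa using mul_nonneg (Finset.sum_nonneg fun i _ => (hγ i).le) (Real.log_nonneg one_le_two)⟩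

lemma activeSets_empty (ha_empty : a ∅ = 0) : activeSets a ∅ = ∅ := by
  simp [activeSets, Finset.filter_singleton, ha_empty]

lemma sum_active_eq_one (ha_nonneg : ∀ J, 0 ≤ a J) (ha_sum : ∑ J, a J = 1) :
    ∑ J : Active a, a J.1 = 1 := by
  rw [← ha_sum, Finset.sum_coe_sort (activeSets a Finset.univ) a, activeSets, Finset.powerset_univ]
  exact Finset.sum_filter_of_ne fun J _ h => lt_of_le_of_ne (ha_nonneg J) h.symm

lemma sum_filter_univ {M : Type*} [AddCommMonoid M] (f : Active a → M) :
    ∑ J : Active a with J.1 ∈ activeSets a Finset.univ, f J = ∑ J, f J := by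
  rw [Finset.filter_true_of_mem fun J _ => J.2]

/-- If the normalized vector `x / N` lies in `(1 + ε) Δ⁺`, up to signs, then its energy is bounded
by the supremum of `ψ` over `Δ⁺` plus its quadratic cost. -/
lemma mul_sum_le_of_mem (ha_empty : a ∅ = 0) {γ : Fin n → ℝ}
    {β M ε : ℝ} (hβ : 0 ≤ β) (hM : ∀ l ∈ deltaPlus a γ, psi a β l ≤ M) (hε : 0 < ε) (hN : 0 < N)
    (x : Active a → ℝ)
    (hx : ∀ A : Finset (Fin n), A.Nonempty →
      ∑ J : Active a with J.1 ∈ activeSets a A, x J ^ 2 / (2 * (a J.1 * N)) ≤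
        N * ((1 + ε) ^ 2 * ((∑ i ∈ A, γ i) * Real.log 2))) :
    β * ∑ J, x J ≤ N * ((1 + ε) * M) +
      (1 + ε)⁻¹ * ∑ J, x J ^ 2 / (2 * (a J.1 * N)) := by
  have hN' : (0 : ℝ) < N := by exact_mod_cast hN
  have hε1 : 0 < 1 + ε := by linarith
  set l : Active a → ℝ := fun J => max (x J) 0 / (N * (1 + ε)) with hl
  have hlsq : ∀ J, l J ^ 2 / (2 * a J.1) ≤
      (N * (1 + ε) ^ 2)⁻¹ * (x J ^ 2 / (2 * (a J.1 * N))) := fun J => by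
    have ha := J.pos
    have h1 : max (x J) 0 ^ 2 ≤ x J ^ 2 := by
      rcases max_cases (x J) 0 with h | h
      · rw [h.1]
      · rw [h.1]; simpa using sq_nonneg (x J)
    calc l J ^ 2 / (2 * a J.1) = (N * (1 + ε) ^ 2)⁻¹ * (max (x J) 0 ^ 2 / (2 * (a J.1 * N))) := by
          simp only [hl]; field_simp
      _ ≤ _ := by gcongr
  have hmem : l ∈ deltaPlus a γ := by
    refine ⟨fun J => by simp only [hl]; positivity, fun A => ?_⟩
    rcases A.eq_empty_or_nonempty with rfl | hA
    · simp [activeSets_empty ha_empty]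
    calc _ ≤ ∑ J : Active a with J.1 ∈ activeSets a A,
          (N * (1 + ε) ^ 2)⁻¹ * (x J ^ 2 / (2 * (a J.1 * N))) :=
          Finset.sum_le_sum fun J _ => hlsq J
      _ ≤ (N * (1 + ε) ^ 2)⁻¹ * (N * ((1 + ε) ^ 2 * ((∑ i ∈ A, γ i) * Real.log 2))) := by
          rw [← Finset.mul_sum]
          gcongr
          exact hx A hA
      _ = _ := by field_simp
  have hψ := hM l hmem
  have hpsi : psi a β l = β * ∑ J, l J - ∑ J, l J ^ 2 / (2 * a J.1) := by
    rw [psi, Finset.sum_sub_distrib, Finset.mul_sum]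
  set S := ∑ J : Active a, l J ^ 2 / (2 * a J.1) with hS
  set U := ∑ J : Active a, x J ^ 2 / (2 * (a J.1 * N)) with hU
  have hSU : S ≤ (N * (1 + ε) ^ 2)⁻¹ * U := by
    rw [hS, hU, Finset.mul_sum]
    exact Finset.sum_le_sum fun J _ => hlsq J
  have hxl : β * ∑ J, x J ≤ N * (1 + ε) * (β * ∑ J, l J) := by
    rw [mul_left_comm, Finset.mul_sum (a := (N : ℝ) * (1 + ε))]
    refine mul_le_mul_of_nonneg_left (Finset.sum_le_sum fun J _ => ?_) hβ
    simp only [hl]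
    rw [mul_div_cancel₀ _ (by positivity)]
    exact le_max_left _ _
  calc β * ∑ J, x J ≤ N * (1 + ε) * (β * ∑ J, l J) := hxl
    _ ≤ N * (1 + ε) * (M + (N * (1 + ε) ^ 2)⁻¹ * U) := by
        refine mul_le_mul_of_nonneg_left ?_ (by positivity)
        linarith
    _ = N * ((1 + ε) * M) + (1 + ε)⁻¹ * U := by field_simp

/-- Extension of a partial configuration by the value `0`. -/
def extendConfig (hm : ∀ i, 0 < m i) (A : Finset (Fin n)) (τ : LocalConfig m A) : Config m :=
  fun i => if h : i ∈ A then τ ⟨i, h⟩ else ⟨0, hm i⟩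

omit [MeasurableSpace Ω] in
lemma quadEnergy_extendConfig (hm : ∀ i, 0 < m i) (A : Finset (Fin n)) (σ : Config m) (ω : Ω) :
    quadEnergy N X A (extendConfig hm A (σ.proj A)) ω = quadEnergy N X A σ ω := by
  refine Finset.sum_congr rfl fun J hJ => ?_
  have hJA : J.1 ⊆ A := mem_activeSets_iff.1 (Finset.mem_filter.1 hJ).2
  have : (extendConfig hm A (σ.proj A)).proj J.1 = σ.proj J.1 := by
    funext j
    simp [Config.proj, extendConfig, hJA j.2]
  rw [this]

/-- The total exponential exceedance: it dominates the indicator of the event that some partial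
configuration on a nonempty `A` has quadratic energy at least `b A`. -/
noncomputable def exceedance (N : ℕ) (X : (J : Active a) → LocalConfig m J.1 → Ω → ℝ)
    (hm : ∀ i, 0 < m i) (t : ℝ) (b : Finset (Fin n) → ℝ) (ω : Ω) : ℝ :=
  ∑ A : Finset (Fin n) with A.Nonempty, ∑ τ : LocalConfig m A,
    Real.exp (t * quadEnergy N X A (extendConfig hm A τ) ω) * Real.exp (-(t * b A))

omit [MeasurableSpace Ω] in
lemma exceedance_nonneg (hm : ∀ i, 0 < m i) (t : ℝ) (b : Finset (Fin n) → ℝ) (ω : Ω) :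
    0 ≤ exceedance N X hm t b ω :=
  Finset.sum_nonneg fun _ _ => Finset.sum_nonneg fun _ _ => by positivity

omit [MeasurableSpace Ω] in
lemma one_le_exceedance (hm : ∀ i, 0 < m i) {t : ℝ} (ht : 0 ≤ t) {b : Finset (Fin n) → ℝ} {ω : Ω}
    {A : Finset (Fin n)} (hA : A.Nonempty) {σ : Config m} (h : b A ≤ quadEnergy N X A σ ω) :
    1 ≤ exceedance N X hm t b ω := by
  have h1 : 1 ≤ Real.exp (t * quadEnergy N X A (extendConfig hm A (σ.proj A)) ω) *
      Real.exp (-(t * b A)) := by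
    rw [quadEnergy_extendConfig, ← Real.exp_add]
    apply Real.one_le_exp
    nlinarith
  refine h1.trans ?_
  refine le_trans ?_ (Finset.single_le_sum
    (f := fun A : Finset (Fin n) => ∑ τ : LocalConfig m A,
      Real.exp (t * quadEnergy N X A (extendConfig hm A τ) ω) * Real.exp (-(t * b A)))
    (fun _ _ => Finset.sum_nonneg fun _ _ => by positivity)
    (Finset.mem_filter.2 ⟨Finset.mem_univ A, hA⟩))
  exact Finset.single_le_sum
    (f := fun τ : LocalConfig m A =>
      Real.exp (t * quadEnergy N X A (extendConfig hm A τ) ω) * Real.exp (-(t * b A)))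
    (fun _ _ => by positivity) (Finset.mem_univ (σ.proj A))

/-- The mean over all configurations of `exp (t U_I(σ))`. -/
noncomputable def meanExpQuad (N : ℕ) (X : (J : Active a) → LocalConfig m J.1 → Ω → ℝ)
    (t : ℝ) (ω : Ω) : ℝ :=
  (∑ σ : Config m, Real.exp (t * quadEnergy N X Finset.univ σ ω)) / (Fintype.card (Config m) : ℝ)

omit [MeasurableSpace Ω] in
lemma log_partitionFunction_le_add (ha_nonneg : ∀ J, 0 ≤ a J) (ha_empty : a ∅ = 0)
    (ha_sum : ∑ J, a J = 1) {γ : Fin n → ℝ} (hγ : ∀ i, 0 < γ i)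
    (hm : ∀ i, 0 < m i)
    {β M ε : ℝ} (hβ : 0 ≤ β) (hM : ∀ l ∈ deltaPlus a γ, psi a β l ≤ M) (hε : 0 < ε) (hN : 0 < N)
    (ω : Ω) :
    Real.log (partitionFunction β (hamiltonian X ω)) ≤
      N * ((1 + ε) * M) + meanExpQuad N X (1 + ε)⁻¹ ω +
      N * (β ^ 2 * (1 + ε) / 2) * exceedance N X hm (1 + ε)⁻¹
        (fun A => N * ((1 + ε) ^ 2 * ((∑ i ∈ A, γ i) * Real.log 2))) ω := by
  set b : Finset (Fin n) → ℝ := fun A => N * ((1 + ε) ^ 2 * ((∑ i ∈ A, γ i) * Real.log 2)) with hb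
  have hN' : (0 : ℝ) < N := by exact_mod_cast hN
  have hε1 : 0 < 1 + ε := by linarith
  have hV := exceedance_nonneg (N := N) (X := X) hm (1 + ε)⁻¹ b ω
  have hM0 : 0 ≤ M := by simpa [psi] using hM 0 (zero_mem_deltaPlus hγ)
  by_cases hgood : ∀ A : Finset (Fin n), A.Nonempty → ∀ σ, quadEnergy N X A σ ω ≤ b A
  · have h := log_partitionFunction_le hm β (hamiltonian X ω)
      (c := N * ((1 + ε) * M))
      (w := fun σ => (1 + ε)⁻¹ * quadEnergy N X Finset.univ σ ω) fun σ => by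
        have := mul_sum_le_of_mem ha_empty hβ hM hε hN (fun J => X J (σ.proj J.1) ω)
          fun A hA => hgood A hA σ
        rw [quadEnergy, sum_filter_univ]
        exact this
    refine h.trans ?_
    have : 0 ≤ N * (β ^ 2 * (1 + ε) / 2) * exceedance N X hm (1 + ε)⁻¹ b ω := by positivity
    rw [meanExpQuad]
    linarith
  · push Not at hgood
    obtain ⟨A, hA, σ, hσ⟩ := hgood
    have hV1 := one_le_exceedance (N := N) (X := X) hm (inv_nonneg.2 hε1.le) hA hσ.le
    have h := log_partitionFunction_le hm β (hamiltonian X ω)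
      (c := N * (β ^ 2 * (1 + ε) / 2))
      (w := fun σ => (1 + ε)⁻¹ * quadEnergy N X Finset.univ σ ω) fun σ => by
        have hs : (N : ℝ) * (β ^ 2 * (1 + ε) / 2) =
            ∑ J : Active a, a J.1 * (N * (β ^ 2 * (1 + ε) / 2)) := by
          rw [← Finset.sum_mul, sum_active_eq_one ha_nonneg ha_sum, one_mul]
        rw [quadEnergy, sum_filter_univ, hs, hamiltonian, Finset.mul_sum, Finset.mul_sum,
          ← Finset.sum_add_distrib]
        refine Finset.sum_le_sum fun J _ => ?_
        have ha := J.pos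
        rw [← sub_nonneg]
        have : a J.1 * (N * (β ^ 2 * (1 + ε) / 2)) +
            (1 + ε)⁻¹ * ((X J (σ.proj J.1) ω) ^ 2 / (2 * (a J.1 * N))) -
            β * X J (σ.proj J.1) ω =
            (a J.1 * N * β * (1 + ε) - X J (σ.proj J.1) ω) ^ 2 *
              (2 * (a J.1 * N) * (1 + ε))⁻¹ := by
          field_simp
          ring
        rw [this]
        positivity
    have h0 : 0 ≤ (N : ℝ) * ((1 + ε) * M) := by positivity
    have h1 : (N : ℝ) * (β ^ 2 * (1 + ε) / 2) ≤
        N * (β ^ 2 * (1 + ε) / 2) * exceedance N X hm (1 + ε)⁻¹ b ω :=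
      le_mul_of_one_le_right (by positivity) hV1
    refine h.trans ?_
    rw [meanExpQuad]
    linarith

variable [IsProbabilityMeasure μ]

lemma IsDisorder.integrable_meanExpQuad (hX : IsDisorder a N m μ X)
    (hmeas : ∀ J τ, Measurable (X J τ)) (hN : 0 < N) {t : ℝ} (ht : t < 1) :
    Integrable (meanExpQuad N X t) μ :=
  (integrable_finsetSum _ fun σ _ => hX.integrable_exp_quadEnergy hmeas hN ht _ σ).div_const _

lemma IsDisorder.integral_meanExpQuad_le (hX : IsDisorder a N m μ X) (hm : ∀ i, 0 < m i)
    (hmeas : ∀ J τ, Measurable (X J τ)) (hN : 0 < N) {t : ℝ} (ht0 : 0 ≤ t) (ht : t < 1) :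
    ∫ ω, meanExpQuad N X t ω ∂μ ≤ (√(1 - t))⁻¹ ^ Fintype.card (Active a) := by
  have : Nonempty (Config m) := ⟨fun i => ⟨0, hm i⟩⟩
  have hc : (0 : ℝ) < Fintype.card (Config m) := by exact_mod_cast Fintype.card_pos
  unfold meanExpQuad
  rw [integral_div, integral_finsetSum _
    fun σ _ => hX.integrable_exp_quadEnergy hmeas hN ht _ σ, div_le_iff₀ hc]
  calc _ ≤ ∑ _ : Config m, (√(1 - t))⁻¹ ^ Fintype.card (Active a) :=
        Finset.sum_le_sum fun σ _ => hX.integral_exp_quadEnergy_le hmeas hN ht0 ht _ σ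
    _ = _ := by rw [Finset.sum_const, Finset.card_univ, nsmul_eq_mul, mul_comm]

lemma IsDisorder.integrable_exceedance (hX : IsDisorder a N m μ X) (hm : ∀ i, 0 < m i)
    (hmeas : ∀ J τ, Measurable (X J τ)) (hN : 0 < N) {t : ℝ} (ht : t < 1)
    (b : Finset (Fin n) → ℝ) :
    Integrable (exceedance N X hm t b) μ :=
  integrable_finsetSum _ fun _ _ => integrable_finsetSum _ fun _ _ =>
    (hX.integrable_exp_quadEnergy hmeas hN ht _ _).mul_const _

lemma IsDisorder.integral_exceedance_le (hX : IsDisorder a N m μ X) (hm : ∀ i, 0 < m i)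
    (hmeas : ∀ J τ, Measurable (X J τ)) (hN : 0 < N) {t : ℝ} (ht0 : 0 ≤ t) (ht : t < 1)
    (b : Finset (Fin n) → ℝ) :
    ∫ ω, exceedance N X hm t b ω ∂μ ≤ (√(1 - t))⁻¹ ^ Fintype.card (Active a) *
      ∑ A : Finset (Fin n) with A.Nonempty, (∏ i ∈ A, (m i : ℝ)) * Real.exp (-(t * b A)) := by
  unfold exceedance
  rw [integral_finsetSum _ fun _ _ => integrable_finsetSum _ fun _ _ =>
    (hX.integrable_exp_quadEnergy hmeas hN ht _ _).mul_const _, Finset.mul_sum]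
  refine Finset.sum_le_sum fun A _ => ?_
  rw [integral_finsetSum _ fun _ _ => (hX.integrable_exp_quadEnergy hmeas hN ht _ _).mul_const _]
  have hcard : (Fintype.card (LocalConfig m A) : ℝ) = ∏ i ∈ A, (m i : ℝ) := by
    rw [Fintype.card_pi, ← Finset.prod_coe_sort A fun i => (m i : ℝ)]
    simp only [Fintype.card_fin, Nat.cast_prod]
  calc _ ≤ ∑ _ : LocalConfig m A,
        (√(1 - t))⁻¹ ^ Fintype.card (Active a) * Real.exp (-(t * b A)) := by
        refine Finset.sum_le_sum fun τ _ => ?_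
        rw [integral_mul_const]
        gcongr
        exact hX.integral_exp_quadEnergy_le hmeas hN ht0 ht _ _
    _ = _ := by rw [Finset.sum_const, Finset.card_univ, nsmul_eq_mul, hcard]; ring

lemma IsDisorder.integral_finiteFreeEnergy_le (hX : IsDisorder a N m μ X)
    (ha_nonneg : ∀ J, 0 ≤ a J) (ha_empty : a ∅ = 0)
    (ha_sum : ∑ J, a J = 1) {γ : Fin n → ℝ} (hγ : ∀ i, 0 < γ i)
    (hm : ∀ i, 0 < m i) (hmeas : ∀ J τ, Measurable (X J τ))
    {β M ε : ℝ} (hβ : 0 ≤ β) (hM : ∀ l ∈ deltaPlus a γ, psi a β l ≤ M) (hε : 0 < ε)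
    (hN : 0 < N) :
    ∫ ω, finiteFreeEnergy N β (hamiltonian X ω) ∂μ ≤
      (1 + ε) * M +
      (√(1 - (1 + ε)⁻¹))⁻¹ ^ Fintype.card (Active a) / N +
      (β ^ 2 * (1 + ε) / 2) * ((√(1 - (1 + ε)⁻¹))⁻¹ ^ Fintype.card (Active a) *
        ∑ A : Finset (Fin n) with A.Nonempty, (∏ i ∈ A, (m i : ℝ)) *
          Real.exp (-(N * ((1 + ε) * ((∑ i ∈ A, γ i) * Real.log 2))))) := by
  have hN' : (0 : ℝ) < N := by exact_mod_cast hN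
  have hε1 : 0 < 1 + ε := by linarith
  have ht0 : 0 ≤ (1 + ε)⁻¹ := by positivity
  have ht : (1 + ε)⁻¹ < 1 := inv_lt_one_of_one_lt₀ (by linarith)
  set b : Finset (Fin n) → ℝ := fun A => N * ((1 + ε) ^ 2 * ((∑ i ∈ A, γ i) * Real.log 2)) with hb
  have hW := hX.integral_meanExpQuad_le hm hmeas hN ht0 ht
  have hV := hX.integral_exceedance_le hm hmeas hN ht0 ht b
  have iW := hX.integrable_meanExpQuad hmeas hN ht
  have iV := hX.integrable_exceedance hm hmeas hN ht b
  have htb : ∀ A, (1 + ε)⁻¹ * b A = N * ((1 + ε) * ((∑ i ∈ A, γ i) * Real.log 2)) := fun A => by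
    simp only [hb]
    field_simp
  simp only [htb] at hV
  have key : ∫ ω, Real.log (partitionFunction β (hamiltonian X ω)) ∂μ ≤
      N * ((1 + ε) * M) + ∫ ω, meanExpQuad N X (1 + ε)⁻¹ ω ∂μ +
      N * (β ^ 2 * (1 + ε) / 2) * ∫ ω, exceedance N X hm (1 + ε)⁻¹ b ω ∂μ := by
    refine (integral_mono (hX.integrable_log_partitionFunction hm hmeas β)
      (((integrable_const _).add iW).add (iV.const_mul _)) fun ω =>
        log_partitionFunction_le_add ha_nonneg ha_empty ha_sum hγ hm hβ hM hε hN ω).trans ?_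
    rw [integral_add' ((integrable_const _).add iW) (iV.const_mul _),
      integral_add' (integrable_const _) iW]
    simp [integral_const_mul]
  unfold finiteFreeEnergy
  rw [integral_const_mul, one_div, inv_mul_le_iff₀ hN']
  refine key.trans ?_
  rw [mul_add (N : ℝ), mul_add (N : ℝ), mul_div_cancel₀ _ hN'.ne', ← mul_assoc (N : ℝ) (β ^ 2 * (1 + ε) / 2)]
  gcongr

end NonhierGREM

namespace NonhierGREM

variable {n : ℕ} {a : Finset (Fin n) → ℝ} {N : ℕ} {m : Fin n → ℕ}
  {Ω : Type*} [MeasurableSpace Ω] {μ : Measure Ω}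
  {X : (J : Active a) → LocalConfig m J.1 → Ω → ℝ}

/-! ### The lower bound -/

/-- The event that `X^J_{σ_J} ≥ l_J N` for every `J ∈ 𝒫`. -/
def levelEvent (N : ℕ) (X : (J : Active a) → LocalConfig m J.1 → Ω → ℝ) (l : Active a → ℝ)
    (σ : Config m) : Set Ω :=
  ⋂ J : Active a, X J (σ.proj J.1) ⁻¹' Set.Ici (l J * N)

/-- `ℙ(X^J_τ ≥ l_J N)`. -/
noncomputable def levelProb (a : Finset (Fin n) → ℝ) (N : ℕ) (l : Active a → ℝ) (J : Active a) :
    ℝ :=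
  (gaussianReal 0 (Real.toNNReal (a J.1 * N))).real (Set.Ici (l J * N))

/-- The index set of the variables seen by the configuration `σ`. -/
noncomputable def siteSet (a : Finset (Fin n) → ℝ) (σ : Config m) :
    Finset (Σ J : Active a, LocalConfig m J.1) :=
  Finset.univ.image fun J => ⟨J, σ.proj J.1⟩

lemma mem_siteSet {σ : Config m} {p : Σ J : Active a, LocalConfig m J.1} :
    p ∈ siteSet a σ ↔ σ.proj p.1.1 = p.2 := by
  obtain ⟨J, τ⟩ := p
  simp only [siteSet, Finset.mem_image, Finset.mem_univ, true_and, Sigma.mk.injEq]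
  constructor
  · rintro ⟨J', rfl, h⟩
    exact eq_of_heq h
  · rintro h
    exact ⟨J, rfl, heq_of_eq h⟩

lemma prod_siteSet (σ : Config m) (q : Active a → ℝ) :
    ∏ p ∈ siteSet a σ, q p.1 = ∏ J, q J :=
  Finset.prod_image fun _ _ _ _ h => congrArg Sigma.fst h

lemma prod_siteSet_inter (σ σ' : Config m) (q : Active a → ℝ) :
    ∏ p ∈ siteSet a σ ∩ siteSet a σ', q p.1 =
      ∏ J : Active a with σ.proj J.1 = σ'.proj J.1, q J := by
  have : siteSet a σ ∩ siteSet a σ' =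
      (Finset.univ.filter fun J : Active a => σ.proj J.1 = σ'.proj J.1).image
        fun J => ⟨J, σ.proj J.1⟩ := by
    ext ⟨J, τ⟩
    simp only [Finset.mem_inter, mem_siteSet, Finset.mem_image, Finset.mem_filter,
      Finset.mem_univ, true_and, Sigma.mk.injEq]
    constructor
    · rintro ⟨h1, h2⟩
      exact ⟨J, h1.trans h2.symm, rfl, heq_of_eq h1⟩
    · rintro ⟨J', h, rfl, h2⟩
      exact ⟨eq_of_heq h2, h.symm.trans (eq_of_heq h2)⟩
  rw [this, Finset.prod_image fun _ _ _ _ h => congrArg Sigma.fst h]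

omit [MeasurableSpace Ω] in
lemma levelEvent_eq_iInter (l : Active a → ℝ) (σ : Config m) :
    levelEvent N X l σ = ⋂ p ∈ siteSet a σ, X p.1 p.2 ⁻¹' Set.Ici (l p.1 * N) := by
  ext ω
  simp only [levelEvent, Set.mem_iInter]
  constructor
  · rintro h ⟨J, τ⟩ hp
    have hτ : σ.proj J.1 = τ := mem_siteSet.1 hp
    subst hτ
    exact h J
  · intro h J
    exact h ⟨J, σ.proj J.1⟩ (mem_siteSet.2 rfl)

lemma measurableSet_levelEvent (hmeas : ∀ J τ, Measurable (X J τ)) (l : Active a → ℝ)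
    (σ : Config m) : MeasurableSet (levelEvent N X l σ) :=
  MeasurableSet.iInter fun J => hmeas J _ measurableSet_Ici

lemma IsDisorder.measureReal_biInter (hX : IsDisorder a N m μ X) (l : Active a → ℝ)
    (S : Finset (Σ J : Active a, LocalConfig m J.1)) :
    μ.real (⋂ p ∈ S, X p.1 p.2 ⁻¹' Set.Ici (l p.1 * N)) = ∏ p ∈ S, levelProb a N l p.1 := by
  rw [measureReal_def, hX.indep.measure_inter_preimage_eq_mul S
    (sets := fun p => Set.Ici (l p.1 * N)) (fun _ _ => measurableSet_Ici), ENNReal.toReal_prod]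
  refine Finset.prod_congr rfl fun p _ => ?_
  exact (hX.hasLaw p.1 p.2).measureReal_eq (p := fun x => l p.1 * N ≤ x) measurableSet_Ici

lemma IsDisorder.measureReal_levelEvent (hX : IsDisorder a N m μ X) (l : Active a → ℝ)
    (σ : Config m) : μ.real (levelEvent N X l σ) = ∏ J, levelProb a N l J := by
  rw [levelEvent_eq_iInter, hX.measureReal_biInter, prod_siteSet]

lemma IsDisorder.measureReal_levelEvent_inter (hX : IsDisorder a N m μ X) (l : Active a → ℝ)
    (σ σ' : Config m) :
    μ.real (levelEvent N X l σ ∩ levelEvent N X l σ') *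
      ∏ J : Active a with σ.proj J.1 = σ'.proj J.1, levelProb a N l J =
      (∏ J, levelProb a N l J) ^ 2 := by
  have h : levelEvent N X l σ ∩ levelEvent N X l σ' =
      ⋂ p ∈ siteSet a σ ∪ siteSet a σ', X p.1 p.2 ⁻¹' Set.Ici (l p.1 * N) := by
    rw [levelEvent_eq_iInter, levelEvent_eq_iInter, Finset.set_biInter_inter]
  rw [h, hX.measureReal_biInter, ← prod_siteSet_inter, Finset.prod_union_inter, prod_siteSet,
    prod_siteSet, sq]

/-- The number of configurations in the level event, normalized to have mean one. -/
noncomputable def levelMean (N : ℕ) (X : (J : Active a) → LocalConfig m J.1 → Ω → ℝ)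
    (l : Active a → ℝ) (ω : Ω) : ℝ :=
  (∑ σ : Config m, (levelEvent N X l σ).indicator 1 ω) /
    ((Fintype.card (Config m) : ℝ) * ∏ J, levelProb a N l J)

lemma card_agree (σ : Config m) (A : Finset (Fin n)) :
    ((Finset.univ.filter fun σ' : Config m => ∀ i ∈ A, σ i = σ' i).card : ℝ) *
      ∏ i ∈ A, (m i : ℝ) = Fintype.card (Config m) := by
  have h : (Finset.univ.filter fun σ' : Config m => ∀ i ∈ A, σ i = σ' i) =
      Fintype.piFinset fun i => if i ∈ A then {σ i} else Finset.univ := by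
    ext σ'
    simp only [Finset.mem_filter, Finset.mem_univ, true_and, Fintype.mem_piFinset]
    refine forall_congr' fun i => ?_
    by_cases hi : i ∈ A <;> simp [hi, eq_comm]
  rw [h, Fintype.card_piFinset, Fintype.card_pi, Nat.cast_prod, Nat.cast_prod,
    ← Finset.prod_mul_prod_compl A, ← Finset.prod_mul_prod_compl A (fun i => _)]
  have h1 : ∏ i ∈ A, (((if i ∈ A then {σ i} else Finset.univ : Finset (Fin (m i))).card : ℕ) : ℝ)
      = 1 := Finset.prod_eq_one fun i hi => by simp [hi]
  have h2 : ∏ i ∈ Aᶜ, (((if i ∈ A then {σ i} else Finset.univ : Finset (Fin (m i))).card : ℕ) : ℝ)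
      = ∏ i ∈ Aᶜ, (m i : ℝ) := Finset.prod_congr rfl fun i hi => by
        simp [Finset.mem_compl.1 hi]
  rw [h1, h2, one_mul, mul_comm]
  simp

variable [IsProbabilityMeasure μ]

lemma integrable_indicator_levelEvent (hmeas : ∀ J τ, Measurable (X J τ)) (l : Active a → ℝ)
    (σ : Config m) : Integrable ((levelEvent N X l σ).indicator (1 : Ω → ℝ)) μ :=
  (integrable_const (1 : ℝ)).indicator (measurableSet_levelEvent hmeas l σ)

lemma integrable_levelMean (hmeas : ∀ J τ, Measurable (X J τ)) (l : Active a → ℝ) :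
    Integrable (levelMean N X l) μ :=
  (integrable_finsetSum _ fun σ _ => integrable_indicator_levelEvent hmeas l σ).div_const _

lemma IsDisorder.integral_levelMean (hX : IsDisorder a N m μ X) (hm : ∀ i, 0 < m i)
    (hmeas : ∀ J τ, Measurable (X J τ)) (l : Active a → ℝ) (hq : ∀ J, 0 < levelProb a N l J) :
    ∫ ω, levelMean N X l ω ∂μ = 1 := by
  have : Nonempty (Config m) := ⟨fun i => ⟨0, hm i⟩⟩
  have hc : (0 : ℝ) < Fintype.card (Config m) := by exact_mod_cast Fintype.card_pos
  have hQ : 0 < ∏ J, levelProb a N l J := Finset.prod_pos fun J _ => hq J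
  unfold levelMean
  rw [integral_div, integral_finsetSum _ fun σ _ => integrable_indicator_levelEvent hmeas l σ]
  simp only [integral_indicator_one (measurableSet_levelEvent hmeas l _),
    hX.measureReal_levelEvent, Finset.sum_const, Finset.card_univ, nsmul_eq_mul]
  exact div_self (by positivity)

omit [MeasurableSpace Ω] in
lemma levelMean_sq (l : Active a → ℝ) (ω : Ω) :
    levelMean N X l ω ^ 2 = (∑ σ : Config m, ∑ σ' : Config m,
      (levelEvent N X l σ ∩ levelEvent N X l σ').indicator 1 ω) /
        ((Fintype.card (Config m) : ℝ) * ∏ J, levelProb a N l J) ^ 2 := by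
  rw [levelMean, div_pow, sq, Finset.sum_mul_sum]
  simp only [Set.inter_indicator_one, Pi.mul_apply]

lemma integrable_levelMean_sq (hmeas : ∀ J τ, Measurable (X J τ)) (l : Active a → ℝ) :
    Integrable (fun ω => levelMean N X l ω ^ 2) μ := by
  simp only [levelMean_sq]
  exact (integrable_finsetSum _ fun σ _ => integrable_finsetSum _ fun σ' _ =>
    (integrable_const (1 : ℝ)).indicator ((measurableSet_levelEvent hmeas l σ).inter
      (measurableSet_levelEvent hmeas l σ'))).div_const _

lemma IsDisorder.integral_levelMean_sq_le (hX : IsDisorder a N m μ X) (hm : ∀ i, 0 < m i)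
    (hmeas : ∀ J τ, Measurable (X J τ)) (l : Active a → ℝ) (hq : ∀ J, 0 < levelProb a N l J) :
    ∫ ω, levelMean N X l ω ^ 2 ∂μ ≤ ∑ A : Finset (Fin n), (∏ i ∈ A, (m i : ℝ))⁻¹ *
      (∏ J : Active a with J.1 ∈ activeSets a A, levelProb a N l J)⁻¹ := by
  have : Nonempty (Config m) := ⟨fun i => ⟨0, hm i⟩⟩
  set c : ℝ := (Fintype.card (Config m) : ℝ) with hcdef
  have hc : 0 < c := by rw [hcdef]; exact_mod_cast Fintype.card_pos
  set Q := ∏ J, levelProb a N l J with hQdef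
  have hQ : 0 < Q := Finset.prod_pos fun J _ => hq J
  have hint : ∀ σ σ' : Config m, Integrable
      ((levelEvent N X l σ ∩ levelEvent N X l σ').indicator (1 : Ω → ℝ)) μ := fun σ σ' =>
    (integrable_const (1 : ℝ)).indicator ((measurableSet_levelEvent hmeas l σ).inter
      (measurableSet_levelEvent hmeas l σ'))
  set R : Finset (Fin n) → ℝ := fun A =>
    (∏ J : Active a with J.1 ∈ activeSets a A, levelProb a N l J)⁻¹ with hR
  have hRpos : ∀ A, 0 < R A := fun A => inv_pos.2 (Finset.prod_pos fun J _ => hq J)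
  have hpair : ∀ σ σ' : Config m, μ.real (levelEvent N X l σ ∩ levelEvent N X l σ') ≤
      Q ^ 2 * ∑ A : Finset (Fin n), if ∀ i ∈ A, σ i = σ' i then R A else 0 := fun σ σ' => by
    set A₀ : Finset (Fin n) := Finset.univ.filter fun i => σ i = σ' i with hA₀
    have hset : (Finset.univ.filter fun J : Active a => σ.proj J.1 = σ'.proj J.1) =
        Finset.univ.filter fun J : Active a => J.1 ∈ activeSets a A₀ := by
      ext J
      simp only [Finset.mem_filter, Finset.mem_univ, true_and, mem_activeSets_iff]
      constructor
      · intro h i hi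
        simpa [hA₀, Config.proj] using congrFun h ⟨i, hi⟩
      · intro h
        funext i
        simpa [hA₀, Config.proj] using h i.2
    have hprod := hX.measureReal_levelEvent_inter l σ σ'
    rw [hset] at hprod
    have heq : μ.real (levelEvent N X l σ ∩ levelEvent N X l σ') = Q ^ 2 * R A₀ := by
      rw [← hprod, hR]
      have : 0 < ∏ J : Active a with J.1 ∈ activeSets a A₀, levelProb a N l J :=
        Finset.prod_pos fun J _ => hq J
      field_simp
    rw [heq]
    refine mul_le_mul_of_nonneg_left ?_ (by positivity)
    have h1 : R A₀ = if ∀ i ∈ A₀, σ i = σ' i then R A₀ else 0 := by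
      rw [if_pos]
      intro i hi
      exact (Finset.mem_filter.1 hi).2
    rw [h1]
    exact Finset.single_le_sum
      (f := fun A : Finset (Fin n) => if ∀ i ∈ A, σ i = σ' i then R A else 0)
      (fun A _ => by
        split_ifs
        · exact (hRpos A).le
        · exact le_rfl) (Finset.mem_univ A₀)
  simp only [levelMean_sq]
  rw [integral_div, integral_finsetSum _ fun σ _ => integrable_finsetSum _ fun σ' _ => hint σ σ']
  simp only [integral_finsetSum _ fun σ' _ => hint _ σ', integral_indicator_one
    ((measurableSet_levelEvent hmeas l _).inter (measurableSet_levelEvent hmeas l _))]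
  rw [div_le_iff₀ (by positivity)]
  calc _ ≤ ∑ σ : Config m, ∑ σ' : Config m,
        Q ^ 2 * ∑ A : Finset (Fin n), if ∀ i ∈ A, σ i = σ' i then R A else 0 :=
        Finset.sum_le_sum fun σ _ => Finset.sum_le_sum fun σ' _ => hpair σ σ'
    _ = ∑ σ : Config m, Q ^ 2 * ∑ A : Finset (Fin n), (c * (∏ i ∈ A, (m i : ℝ))⁻¹) * R A := by
        refine Finset.sum_congr rfl fun σ _ => ?_
        rw [← Finset.mul_sum, Finset.sum_comm]
        congr 1
        refine Finset.sum_congr rfl fun A _ => ?_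
        rw [← Finset.sum_filter, Finset.sum_const, nsmul_eq_mul]
        congr 1
        have hpos : 0 < ∏ i ∈ A, (m i : ℝ) := Finset.prod_pos fun i _ => by exact_mod_cast hm i
        rw [eq_mul_inv_iff_mul_eq₀ hpos.ne']
        exact card_agree σ A
    _ = _ := by
        rw [Finset.sum_const, Finset.card_univ, nsmul_eq_mul, Finset.sum_mul, Finset.mul_sum,
          Finset.mul_sum]
        refine Finset.sum_congr rfl fun A _ => ?_
        simp only [← hcdef]
        ring

/-- The bound for the variance of `levelMean`. -/
noncomputable def levelVarBound (m : Fin n → ℕ) (a : Finset (Fin n) → ℝ) (N : ℕ)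
    (l : Active a → ℝ) : ℝ :=
  ∑ A : Finset (Fin n) with A.Nonempty, (∏ i ∈ A, (m i : ℝ))⁻¹ *
    (∏ J : Active a with J.1 ∈ activeSets a A, levelProb a N l J)⁻¹

lemma integrable_levelMean_sub_one_sq
    (hmeas : ∀ J τ, Measurable (X J τ)) (l : Active a → ℝ) :
    Integrable (fun ω => (levelMean N X l ω - 1) ^ 2) μ := by
  have h : (fun ω => (levelMean N X l ω - 1) ^ 2) =
      fun ω => levelMean N X l ω ^ 2 - 2 * levelMean N X l ω + 1 := by funext ω; ring
  rw [h]
  exact ((integrable_levelMean_sq hmeas l).sub ((integrable_levelMean hmeas l).const_mul 2)).add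
    (integrable_const _)

lemma IsDisorder.integral_levelMean_sub_one_sq_le (hX : IsDisorder a N m μ X)
    (ha_empty : a ∅ = 0) (hm : ∀ i, 0 < m i)
    (hmeas : ∀ J τ, Measurable (X J τ)) (l : Active a → ℝ) (hq : ∀ J, 0 < levelProb a N l J) :
    ∫ ω, (levelMean N X l ω - 1) ^ 2 ∂μ ≤ levelVarBound m a N l := by
  have h : (fun ω => (levelMean N X l ω - 1) ^ 2) =
      fun ω => levelMean N X l ω ^ 2 - 2 * levelMean N X l ω + 1 := by funext ω; ring
  have i1 := integrable_levelMean_sq (μ := μ) (N := N) hmeas l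
  have i2 := (integrable_levelMean (μ := μ) (N := N) hmeas l).const_mul 2
  rw [h, integral_add (f := fun ω => levelMean N X l ω ^ 2 - 2 * levelMean N X l ω) (i1.sub i2)
    (integrable_const _), integral_sub i1 i2, integral_const_mul,
    hX.integral_levelMean hm hmeas l hq]
  have hle := hX.integral_levelMean_sq_le hm hmeas l hq
  rw [← Finset.sum_filter_add_sum_filter_not Finset.univ
    (fun A : Finset (Fin n) => A.Nonempty)] at hle
  have hempty : (Finset.univ.filter fun A : Finset (Fin n) => ¬ A.Nonempty) = {∅} := by
    ext A
    simp [Finset.not_nonempty_iff_eq_empty]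
  rw [hempty, Finset.sum_singleton, activeSets_empty ha_empty] at hle
  simp only [Finset.prod_empty, Finset.notMem_empty, Finset.filter_false, inv_one, mul_one] at hle
  simp only [integral_const, probReal_univ, smul_eq_mul, mul_one]
  rw [levelVarBound]
  linarith

omit [IsProbabilityMeasure μ] [MeasurableSpace Ω] in
lemma log_partitionFunction_ge_of_levelMean (hm : ∀ i, 0 < m i) {β δ : ℝ} (hβ : 0 ≤ β)
    (l : Active a → ℝ)
    (hq : ∀ J, Real.exp (-(N * (l J ^ 2 / (2 * a J.1) + δ))) ≤ levelProb a N l J) (ω : Ω)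
    (hY : 1 / 2 ≤ levelMean N X l ω) :
    N * (psi a β l - Fintype.card (Active a) * δ) - Real.log 2 ≤
      Real.log (partitionFunction β (hamiltonian X ω)) := by
  have : Nonempty (Config m) := ⟨fun i => ⟨0, hm i⟩⟩
  have hc : (0 : ℝ) < Fintype.card (Config m) := by exact_mod_cast Fintype.card_pos
  have hQ : 0 < ∏ J, levelProb a N l J :=
    Finset.prod_pos fun J _ => (Real.exp_pos _).trans_le (hq J)
  rw [Real.le_log_iff_exp_le (partitionFunction_pos hm _ _), Real.exp_sub,
    Real.exp_log two_pos]
  have hQle : Real.exp (-(N * (∑ J, l J ^ 2 / (2 * a J.1) + Fintype.card (Active a) * δ))) ≤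
      ∏ J, levelProb a N l J := by
    have : -(N * (∑ J, l J ^ 2 / (2 * a J.1) + Fintype.card (Active a) * δ)) =
        ∑ J : Active a, -(N * (l J ^ 2 / (2 * a J.1) + δ)) := by
      rw [Finset.sum_neg_distrib, ← Finset.mul_sum, Finset.sum_add_distrib, Finset.sum_const,
        Finset.card_univ, nsmul_eq_mul]
    rw [this, Real.exp_sum]
    exact Finset.prod_le_prod (fun _ _ => (Real.exp_pos _).le) fun J _ => hq J
  have hZ : Real.exp (N * (β * ∑ J, l J)) * (∏ J, levelProb a N l J) * levelMean N X l ω ≤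
      partitionFunction β (hamiltonian X ω) := by
    have hL : Real.exp (N * (β * ∑ J, l J)) * (∏ J, levelProb a N l J) * levelMean N X l ω =
        (∑ σ : Config m, Real.exp (N * (β * ∑ J, l J)) * (levelEvent N X l σ).indicator 1 ω) /
          (Fintype.card (Config m) : ℝ) := by
      rw [levelMean, ← Finset.mul_sum]
      field_simp
    rw [hL, partitionFunction]
    gcongr with σ
    by_cases hω : ω ∈ levelEvent N X l σ
    · rw [Set.indicator_of_mem hω, Pi.one_apply, mul_one]
      apply Real.exp_le_exp.2
      rw [mul_left_comm, Finset.mul_sum]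
      refine mul_le_mul_of_nonneg_left (Finset.sum_le_sum fun J _ => ?_) hβ
      rw [mul_comm]
      exact Set.mem_iInter.1 hω J
    · rw [Set.indicator_of_notMem hω, mul_zero]
      positivity
  refine le_trans ?_ hZ
  have hpsi : psi a β l = β * ∑ J, l J - ∑ J, l J ^ 2 / (2 * a J.1) := by
    rw [psi, Finset.sum_sub_distrib, Finset.mul_sum]
  have hexp : Real.exp (N * (psi a β l - Fintype.card (Active a) * δ)) =
      Real.exp (N * (β * ∑ J, l J)) *
        Real.exp (-(N * (∑ J, l J ^ 2 / (2 * a J.1) + Fintype.card (Active a) * δ))) := by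
    rw [← Real.exp_add, hpsi]
    congr 1
    ring
  rw [hexp, div_eq_mul_inv]
  have : (2 : ℝ)⁻¹ ≤ levelMean N X l ω := by simpa using hY
  gcongr

/-- The mean over all configurations of `∑_{J ∈ 𝒫} |X^J_{σ_J}|`. -/
noncomputable def meanAbs (X : (J : Active a) → LocalConfig m J.1 → Ω → ℝ) (ω : Ω) : ℝ :=
  (∑ σ : Config m, ∑ J : Active a, |X J (σ.proj J.1) ω|) / (Fintype.card (Config m) : ℝ)

omit [IsProbabilityMeasure μ] [MeasurableSpace Ω] in
lemma neg_mul_meanAbs_le (hm : ∀ i, 0 < m i) {β : ℝ} (hβ : 0 ≤ β) (ω : Ω) :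
    -(β * meanAbs X ω) ≤ Real.log (partitionFunction β (hamiltonian X ω)) := by
  refine le_trans ?_ (mean_le_log_partitionFunction hm β _)
  rw [meanAbs, ← mul_div_assoc, ← neg_div, ← Finset.mul_sum, ← mul_neg, ← Finset.sum_neg_distrib]
  gcongr with σ
  exact (abs_le.1 (Finset.abs_sum_le_sum_abs (fun J : Active a => X J (σ.proj J.1) ω) _)).1

omit [IsProbabilityMeasure μ] [MeasurableSpace Ω] in
lemma meanAbs_nonneg (ω : Ω) : 0 ≤ meanAbs X ω := by
  unfold meanAbs
  positivity

lemma IsDisorder.integrable_meanAbs (hX : IsDisorder a N m μ X) : Integrable (meanAbs X) μ :=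
  (integrable_finsetSum _ fun _ _ => integrable_finsetSum _ fun J _ =>
    (hX.integrable J _).abs).div_const _

lemma IsDisorder.integral_abs_le (hX : IsDisorder a N m μ X) (hN : 0 < N) (J : Active a)
    (τ : LocalConfig m J.1) : ∫ ω, |X J τ ω| ∂μ ≤ (1 + a J.1) * √N := by
  have hN' : (0 : ℝ) < N := by exact_mod_cast hN
  have hs : 0 < √(N : ℝ) := Real.sqrt_pos.2 hN'
  have hint : Integrable (fun ω => √(N : ℝ) + (X J τ ω) ^ 2 / √(N : ℝ)) μ :=
    (integrable_const _).add ((hX.memLp_two J τ).integrable_sq.div_const _)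
  refine (integral_mono (hX.integrable J τ).abs hint fun ω => ?_).trans ?_
  · show |X J τ ω| ≤ √(N : ℝ) + (X J τ ω) ^ 2 / √(N : ℝ)
    rw [← sub_le_iff_le_add', le_div_iff₀ hs, ← sq_abs (X J τ ω)]
    nlinarith [sq_nonneg (|X J τ ω| - √(N : ℝ)), abs_nonneg (X J τ ω)]
  · rw [integral_add (integrable_const _) ((hX.memLp_two J τ).integrable_sq.div_const _),
      integral_div, hX.integral_sq, mul_div_assoc, Real.div_sqrt]
    simp only [integral_const, probReal_univ, smul_eq_mul, one_mul]
    linarith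

lemma IsDisorder.integral_meanAbs_le (hX : IsDisorder a N m μ X) (hm : ∀ i, 0 < m i)
    (hN : 0 < N) :
    ∫ ω, meanAbs X ω ∂μ ≤ (∑ J : Active a, (1 + a J.1)) * √N := by
  have : Nonempty (Config m) := ⟨fun i => ⟨0, hm i⟩⟩
  have hc : (0 : ℝ) < Fintype.card (Config m) := by exact_mod_cast Fintype.card_pos
  unfold meanAbs
  rw [integral_div, integral_finsetSum _ fun _ _ => integrable_finsetSum _ fun J _ =>
    (hX.integrable J _).abs, div_le_iff₀ hc]
  calc _ ≤ ∑ _ : Config m, (∑ J : Active a, (1 + a J.1)) * √N := by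
        refine Finset.sum_le_sum fun σ _ => ?_
        rw [integral_finsetSum _ fun J _ => (hX.integrable J _).abs, Finset.sum_mul]
        exact Finset.sum_le_sum fun J _ => hX.integral_abs_le hN J _
    _ = _ := by rw [Finset.sum_const, Finset.card_univ, nsmul_eq_mul, mul_comm]

lemma IsDisorder.le_integral_finiteFreeEnergy (hX : IsDisorder a N m μ X) (ha_empty : a ∅ = 0)
    (hm : ∀ i, 0 < m i) (hmeas : ∀ J τ, Measurable (X J τ)) {β δ : ℝ} (hβ : 0 ≤ β)
    (l : Active a → ℝ) (hN : 0 < N)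
    (hq : ∀ J, Real.exp (-(N * (l J ^ 2 / (2 * a J.1) + δ))) ≤ levelProb a N l J) :
    (psi a β l - Fintype.card (Active a) * δ - Real.log 2 / N) -
      4 * |psi a β l - Fintype.card (Active a) * δ - Real.log 2 / N| * levelVarBound m a N l -
      β * (∑ J : Active a, (1 + a J.1)) / √N ≤
    ∫ ω, finiteFreeEnergy N β (hamiltonian X ω) ∂μ := by
  have hN' : (0 : ℝ) < N := by exact_mod_cast hN
  set c := N * (psi a β l - Fintype.card (Active a) * δ) - Real.log 2 with hc
  have hcN : psi a β l - Fintype.card (Active a) * δ - Real.log 2 / N = c / N := by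
    rw [hc]; field_simp
  have hq0 : ∀ J, 0 < levelProb a N l J := fun J => (Real.exp_pos _).trans_le (hq J)
  have iY := integrable_levelMean_sub_one_sq (μ := μ) (N := N) hmeas l
  have iW := hX.integrable_meanAbs
  have hpath : ∀ ω, c - 4 * |c| * (levelMean N X l ω - 1) ^ 2 - β * meanAbs X ω ≤
      Real.log (partitionFunction β (hamiltonian X ω)) := fun ω => by
    have hW : 0 ≤ β * meanAbs X ω := mul_nonneg hβ (meanAbs_nonneg ω)
    by_cases hY : 1 / 2 ≤ levelMean N X l ω
    · have := log_partitionFunction_ge_of_levelMean hm hβ l hq ω hY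
      have : 0 ≤ 4 * |c| * (levelMean N X l ω - 1) ^ 2 := by positivity
      linarith
    · have h1 := neg_mul_meanAbs_le (X := X) hm hβ ω
      have h2 : 1 ≤ 4 * (levelMean N X l ω - 1) ^ 2 := by nlinarith
      have h3 : |c| ≤ 4 * |c| * (levelMean N X l ω - 1) ^ 2 := by
        nlinarith [abs_nonneg c]
      have := le_abs_self c
      linarith
  have hint := integral_mono (((integrable_const c).sub (iY.const_mul (4 * |c|))).sub
    (iW.const_mul β)) (hX.integrable_log_partitionFunction hm hmeas β) hpath
  rw [integral_sub' ((integrable_const c).sub (iY.const_mul (4 * |c|))) (iW.const_mul β),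
    integral_sub' (integrable_const c) (iY.const_mul (4 * |c|)), integral_const_mul,
    integral_const_mul] at hint
  simp only [integral_const, probReal_univ, smul_eq_mul, one_mul] at hint
  have hV := hX.integral_levelMean_sub_one_sq_le ha_empty hm hmeas l hq0
  have hA := hX.integral_meanAbs_le hm hN
  have hV' := mul_le_mul_of_nonneg_left hV (by positivity : 0 ≤ 4 * |c|)
  have hA' := mul_le_mul_of_nonneg_left hA hβ
  unfold finiteFreeEnergy
  rw [integral_const_mul, one_div, le_inv_mul_iff₀ hN', hcN, abs_div, abs_of_pos hN']
  have : (N : ℝ) * (c / N - 4 * (|c| / N) * levelVarBound m a N l -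
      β * (∑ J : Active a, (1 + a J.1)) / √N) =
      c - 4 * |c| * levelVarBound m a N l - β * ((∑ J : Active a, (1 + a J.1)) * √N) := by
    have h1 : (N : ℝ) / √N = √N := Real.div_sqrt
    rw [mul_sub, mul_sub, mul_div_cancel₀ _ hN'.ne']
    have h2 : (N : ℝ) * (β * (∑ J : Active a, (1 + a J.1)) / √N) =
      β * (∑ J : Active a, (1 + a J.1)) * (N / √N) := by ring
    rw [h2, h1]
    field_simp
  rw [this]
  linarith

end NonhierGREM

namespace NonhierGREM

variable {n : ℕ} {a : Finset (Fin n) → ℝ} {γ : Fin n → ℝ} {m : ℕ → Fin n → ℕ}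
  {Ω : Type*} [MeasurableSpace Ω] {μ : Measure Ω}
  {X : (N : ℕ) → (J : Active a) → LocalConfig (m N) J.1 → Ω → ℝ}

/-! ### The limit -/

lemma tendsto_sum_log_div
    (hm : ∀ i, Tendsto (fun N : ℕ => Real.logb 2 (m N i) / (N : ℝ)) atTop (𝓝 (γ i)))
    (A : Finset (Fin n)) :
    Tendsto (fun N : ℕ => (∑ i ∈ A, Real.log (m N i)) / (N : ℝ)) atTop
      (𝓝 ((∑ i ∈ A, γ i) * Real.log 2)) := by
  have h := (tendsto_finsetSum A fun i _ => hm i).mul_const (Real.log 2)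
  refine h.congr fun N => ?_
  have : Real.log 2 ≠ 0 := (Real.log_pos one_lt_two).ne'
  rw [Finset.sum_mul, Finset.sum_div]
  refine Finset.sum_congr rfl fun i _ => ?_
  rw [Real.logb]
  field_simp

lemma prod_eq_exp_sum_log (hm_pos : ∀ N i, 0 < m N i) (N : ℕ) (A : Finset (Fin n)) :
    ∏ i ∈ A, (m N i : ℝ) = Real.exp (∑ i ∈ A, Real.log (m N i)) := by
  rw [Real.exp_sum]
  exact Finset.prod_congr rfl fun i _ => (Real.exp_log (by exact_mod_cast hm_pos N i)).symm

lemma tendsto_exp_natCast_mul_of_neg {u : ℕ → ℝ} {b : ℝ} (hb : b < 0)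
    (hu : Tendsto u atTop (𝓝 b)) : Tendsto (fun N : ℕ => Real.exp (N * u N)) atTop (𝓝 0) :=
  Real.tendsto_exp_atBot.comp (tendsto_natCast_atTop_atTop.atTop_mul_neg hb hu)

lemma tendsto_prod_mul_exp_neg (hm_pos : ∀ N i, 0 < m N i)
    (hm : ∀ i, Tendsto (fun N : ℕ => Real.logb 2 (m N i) / (N : ℝ)) atTop (𝓝 (γ i)))
    {A : Finset (Fin n)} {c : ℝ} (hc : (∑ i ∈ A, γ i) * Real.log 2 < c) :
    Tendsto (fun N : ℕ => (∏ i ∈ A, (m N i : ℝ)) * Real.exp (-(N * c))) atTop (𝓝 0) := by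
  refine (tendsto_exp_natCast_mul_of_neg (sub_neg.2 hc)
    ((tendsto_sum_log_div hm A).sub_const c)).congr' ?_
  filter_upwards [eventually_gt_atTop 0] with N hN
  have hN' : (N : ℝ) ≠ 0 := by exact_mod_cast hN.ne'
  rw [prod_eq_exp_sum_log hm_pos, ← Real.exp_add, mul_sub, mul_div_cancel₀ _ hN', sub_eq_add_neg]

lemma tendsto_inv_prod_mul_exp (hm_pos : ∀ N i, 0 < m N i)
    (hm : ∀ i, Tendsto (fun N : ℕ => Real.logb 2 (m N i) / (N : ℝ)) atTop (𝓝 (γ i)))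
    {A : Finset (Fin n)} {c : ℝ} (hc : c < (∑ i ∈ A, γ i) * Real.log 2) :
    Tendsto (fun N : ℕ => (∏ i ∈ A, (m N i : ℝ))⁻¹ * Real.exp (N * c)) atTop (𝓝 0) := by
  refine (tendsto_exp_natCast_mul_of_neg (sub_neg.2 hc)
    ((tendsto_sum_log_div hm A).const_sub c)).congr' ?_
  filter_upwards [eventually_gt_atTop 0] with N hN
  have hN' : (N : ℝ) ≠ 0 := by exact_mod_cast hN.ne'
  rw [prod_eq_exp_sum_log hm_pos, ← Real.exp_neg, ← Real.exp_add, mul_sub, mul_div_cancel₀ _ hN',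
    sub_eq_neg_add]

lemma psi_le (ha : ∑ J : Active a, a J.1 = 1) (β : ℝ) (l : Active a → ℝ) :
    psi a β l ≤ β ^ 2 / 2 := by
  have : β ^ 2 / 2 = ∑ J : Active a, a J.1 * (β ^ 2 / 2) := by rw [← Finset.sum_mul, ha, one_mul]
  rw [psi, this]
  refine Finset.sum_le_sum fun J _ => ?_
  have ha := J.pos
  rw [← sub_nonneg]
  have : a J.1 * (β ^ 2 / 2) - (β * l J - l J ^ 2 / (2 * a J.1)) =
      (a J.1 * β - l J) ^ 2 / (2 * a J.1) := by
    field_simp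
    ring
  rw [this]
  positivity

/-- Every disorder agrees almost surely with a measurable one. -/
lemma IsDisorder.exists_measurable {N : ℕ} {m : Fin n → ℕ}
    {X : (J : Active a) → LocalConfig m J.1 → Ω → ℝ} (hX : IsDisorder a N m μ X) :
    ∃ Y : (J : Active a) → LocalConfig m J.1 → Ω → ℝ, IsDisorder a N m μ Y ∧
      (∀ J τ, Measurable (Y J τ)) ∧ ∀ᵐ ω ∂μ, hamiltonian Y ω = hamiltonian X ω := by
  have hae := fun J τ => (hX.hasLaw J τ).aemeasurable
  refine ⟨fun J τ => (hae J τ).mk (X J τ), ⟨fun J τ => ?_, ?_⟩, fun J τ => (hae J τ).measurable_mk,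
    ?_⟩
  · exact (hX.hasLaw J τ).congr (hae J τ).ae_eq_mk.symm
  · exact hX.indep.congr fun p => (hae p.1 p.2).ae_eq_mk
  · have h : ∀ᵐ ω ∂μ, ∀ J τ, X J τ ω = (hae J τ).mk (X J τ) ω :=
      ae_all_iff.2 fun J => ae_all_iff.2 fun τ => (hae J τ).ae_eq_mk
    filter_upwards [h] with ω hω
    funext σ
    exact Finset.sum_congr rfl fun J _ => (hω J _).symm

variable [IsProbabilityMeasure μ]

lemma eventually_integral_finiteFreeEnergy_lt (ha_nonneg : ∀ J, 0 ≤ a J) (ha_empty : a ∅ = 0)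
    (ha_sum : ∑ J, a J = 1) (hγ : ∀ i, 0 < γ i) (hm_pos : ∀ N i, 0 < m N i)
    (hm : ∀ i, Tendsto (fun N : ℕ => Real.logb 2 (m N i) / (N : ℝ)) atTop (𝓝 (γ i)))
    (hX : ∀ N, IsDisorder a N (m N) μ (X N)) (hmeas : ∀ N J τ, Measurable (X N J τ))
    {β M b : ℝ} (hβ : 0 ≤ β) (hM : ∀ l ∈ deltaPlus a γ, psi a β l ≤ M) (hb : M < b) :
    ∀ᶠ N : ℕ in atTop, ∫ ω, finiteFreeEnergy N β (hamiltonian (X N) ω) ∂μ < b := by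
  obtain ⟨ε, hεb, hε⟩ : ∃ ε : ℝ, (1 + ε) * M < b ∧ 0 < ε := by
    have hc : Tendsto (fun ε : ℝ => (1 + ε) * M) (𝓝[>] 0) (𝓝 ((1 + 0) * M)) :=
      (Continuous.tendsto (by fun_prop) 0).mono_left nhdsWithin_le_nhds
    rw [add_zero, one_mul] at hc
    exact ((hc.eventually (eventually_lt_nhds hb)).and self_mem_nhdsWithin).exists
  set C := (√(1 - (1 + ε)⁻¹))⁻¹ ^ Fintype.card (Active a) with hC
  have hsum : Tendsto (fun N : ℕ => ∑ A : Finset (Fin n) with A.Nonempty,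
      (∏ i ∈ A, (m N i : ℝ)) * Real.exp (-(N * ((1 + ε) * ((∑ i ∈ A, γ i) * Real.log 2)))))
      atTop (𝓝 0) := by
    suffices h : ∀ A ∈ Finset.univ.filter fun A : Finset (Fin n) => A.Nonempty, Tendsto
        (fun N : ℕ => (∏ i ∈ A, (m N i : ℝ)) *
          Real.exp (-(N * ((1 + ε) * ((∑ i ∈ A, γ i) * Real.log 2))))) atTop (𝓝 0) by
      simpa only [Finset.sum_const_zero] using tendsto_finsetSum _ h
    intro A hA
    refine tendsto_prod_mul_exp_neg hm_pos hm ?_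
    have hpos : 0 < (∑ i ∈ A, γ i) * Real.log 2 :=
      mul_pos (Finset.sum_pos (fun i _ => hγ i) (Finset.mem_filter.1 hA).2)
        (Real.log_pos one_lt_two)
    nlinarith
  have hlim := ((tendsto_const_div_atTop_nhds_zero_nat C).const_add ((1 + ε) * M)).add
    ((hsum.const_mul C).const_mul (β ^ 2 * (1 + ε) / 2))
  rw [mul_zero, mul_zero, add_zero, add_zero] at hlim
  filter_upwards [hlim.eventually (eventually_lt_nhds hεb), eventually_gt_atTop 0] with N h1 hN
  exact ((hX N).integral_finiteFreeEnergy_le ha_nonneg ha_empty ha_sum hγ (hm_pos N) (hmeas N)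
    hβ hM hε hN).trans_lt h1

lemma eventually_lt_integral_finiteFreeEnergy_of_strict (ha_empty : a ∅ = 0)
    (hm_pos : ∀ N i, 0 < m N i)
    (hm : ∀ i, Tendsto (fun N : ℕ => Real.logb 2 (m N i) / (N : ℝ)) atTop (𝓝 (γ i)))
    (hX : ∀ N, IsDisorder a N (m N) μ (X N)) (hmeas : ∀ N J τ, Measurable (X N J τ))
    {β b : ℝ} (hβ : 0 ≤ β) {l : Active a → ℝ} (hl : ∀ J, 0 ≤ l J)
    (hstrict : ∀ A : Finset (Fin n), A.Nonempty →
      ∑ J : Active a with J.1 ∈ activeSets a A, l J ^ 2 / (2 * a J.1) <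
        (∑ i ∈ A, γ i) * Real.log 2) (hb : b < psi a β l) :
    ∀ᶠ N : ℕ in atTop, b < ∫ ω, finiteFreeEnergy N β (hamiltonian (X N) ω) ∂μ := by
  obtain ⟨δ, ⟨hδb, hδA⟩, hδ⟩ : ∃ δ : ℝ, (b < psi a β l - Fintype.card (Active a) * δ ∧
      ∀ A : Finset (Fin n), A.Nonempty →
        ∑ J : Active a with J.1 ∈ activeSets a A, (l J ^ 2 / (2 * a J.1) + δ) <
          (∑ i ∈ A, γ i) * Real.log 2) ∧ 0 < δ := by
    have h1 : ∀ᶠ δ : ℝ in 𝓝 0, b < psi a β l - Fintype.card (Active a) * δ :=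
      (Continuous.tendsto (by fun_prop) 0).eventually (lt_mem_nhds (by simpa using hb))
    have h2 : ∀ᶠ δ : ℝ in 𝓝 0, ∀ A : Finset (Fin n), A.Nonempty →
        ∑ J : Active a with J.1 ∈ activeSets a A, (l J ^ 2 / (2 * a J.1) + δ) <
          (∑ i ∈ A, γ i) * Real.log 2 := by
      refine eventually_all.2 fun A => eventually_imp_distrib_left.2 fun hA => ?_
      exact (Continuous.tendsto (by fun_prop) 0).eventually
        (gt_mem_nhds (by simpa only [add_zero] using hstrict A hA))
    exact (((h1.and h2).filter_mono nhdsWithin_le_nhds).and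
      (self_mem_nhdsWithin (s := Set.Ioi 0))).exists
  have hq : ∀ᶠ N : ℕ in atTop, ∀ J : Active a,
      Real.exp (-(N * (l J ^ 2 / (2 * a J.1) + δ))) ≤ levelProb a N l J :=
    eventually_all.2 fun J => eventually_exp_le_gaussianReal_Ici J.pos (hl J) hδ
  set D : ℕ → ℝ := fun N => ∑ A : Finset (Fin n) with A.Nonempty, (∏ i ∈ A, (m N i : ℝ))⁻¹ *
    Real.exp (N * ∑ J : Active a with J.1 ∈ activeSets a A, (l J ^ 2 / (2 * a J.1) + δ)) with hD
  have hDlim : Tendsto D atTop (𝓝 0) := by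
    rw [← Finset.sum_const_zero (s := Finset.univ.filter fun A : Finset (Fin n) => A.Nonempty)]
    exact tendsto_finsetSum _ fun A hA =>
      tendsto_inv_prod_mul_exp hm_pos hm (hδA A (Finset.mem_filter.1 hA).2)
  have hVD : ∀ N : ℕ, (∀ J : Active a,
      Real.exp (-(N * (l J ^ 2 / (2 * a J.1) + δ))) ≤ levelProb a N l J) →
      levelVarBound (m N) a N l ≤ D N := fun N hq => by
    refine Finset.sum_le_sum fun A _ => ?_
    refine mul_le_mul_of_nonneg_left ?_ (inv_nonneg.2 (Finset.prod_nonneg fun i _ => by positivity))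
    rw [← inv_inv (Real.exp _), ← Real.exp_neg, Finset.mul_sum, ← Finset.sum_neg_distrib,
      Real.exp_sum]
    refine inv_anti₀ (Finset.prod_pos fun J _ => Real.exp_pos _) ?_
    exact Finset.prod_le_prod (fun _ _ => (Real.exp_pos _).le) fun J _ => hq J
  have hclim : Tendsto (fun N : ℕ => psi a β l - Fintype.card (Active a) * δ - Real.log 2 / N)
      atTop (𝓝 (psi a β l - Fintype.card (Active a) * δ)) := by
    simpa using (tendsto_const_div_atTop_nhds_zero_nat (Real.log 2)).const_sub
      (psi a β l - Fintype.card (Active a) * δ)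
  have hsqrt : Tendsto (fun N : ℕ => β * (∑ J : Active a, (1 + a J.1)) / √(N : ℝ)) atTop (𝓝 0) :=
    (Real.tendsto_sqrt_atTop.comp tendsto_natCast_atTop_atTop).const_div_atTop _
  have hlim := (hclim.sub ((hclim.abs.const_mul 4).mul hDlim)).sub hsqrt
  rw [mul_zero, sub_zero, sub_zero] at hlim
  filter_upwards [hlim.eventually (lt_mem_nhds hδb), eventually_gt_atTop 0, hq] with N h1 hN hqN
  refine h1.trans_le (le_trans ?_ ((hX N).le_integral_finiteFreeEnergy ha_empty (hm_pos N)
    (hmeas N) hβ l hN hqN))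
  have := mul_le_mul_of_nonneg_left (hVD N hqN) (by positivity :
    0 ≤ 4 * |psi a β l - Fintype.card (Active a) * δ - Real.log 2 / N|)
  linarith

lemma eventually_lt_integral_finiteFreeEnergy (ha_empty : a ∅ = 0) (hγ : ∀ i, 0 < γ i)
    (hm_pos : ∀ N i, 0 < m N i)
    (hm : ∀ i, Tendsto (fun N : ℕ => Real.logb 2 (m N i) / (N : ℝ)) atTop (𝓝 (γ i)))
    (hX : ∀ N, IsDisorder a N (m N) μ (X N)) (hmeas : ∀ N J τ, Measurable (X N J τ))
    {β b : ℝ} (hβ : 0 ≤ β) {l : Active a → ℝ} (hl : l ∈ deltaPlus a γ) (hb : b < psi a β l) :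
    ∀ᶠ N : ℕ in atTop, b < ∫ ω, finiteFreeEnergy N β (hamiltonian (X N) ω) ∂μ := by
  obtain ⟨s, hsb, hs0, hs1⟩ : ∃ s : ℝ, b < psi a β (fun J => s * l J) ∧ 0 < s ∧ s < 1 := by
    have hc : Tendsto (fun s : ℝ => psi a β (fun J => s * l J)) (𝓝[<] 1)
        (𝓝 (psi a β (fun J => 1 * l J))) := by
      refine (Continuous.tendsto ?_ 1).mono_left nhdsWithin_le_nhds
      unfold psi
      fun_prop
    simp only [one_mul] at hc
    exact ((hc.eventually (lt_mem_nhds hb)).and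
      (Ioo_mem_nhdsLT zero_lt_one)).exists
  refine eventually_lt_integral_finiteFreeEnergy_of_strict ha_empty hm_pos hm hX hmeas hβ
    (l := fun J => s * l J) (fun J => mul_nonneg hs0.le (hl.1 J)) (fun A hA => ?_) hsb
  have hpos : 0 < (∑ i ∈ A, γ i) * Real.log 2 :=
    mul_pos (Finset.sum_pos (fun i _ => hγ i) hA) (Real.log_pos one_lt_two)
  calc _ = s ^ 2 * ∑ J : Active a with J.1 ∈ activeSets a A, l J ^ 2 / (2 * a J.1) := by
        rw [Finset.mul_sum]
        refine Finset.sum_congr rfl fun J _ => ?_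
        rw [mul_pow, mul_div_assoc]
    _ ≤ s ^ 2 * ((∑ i ∈ A, γ i) * Real.log 2) := by
        gcongr
        exact hl.2 A
    _ < _ := mul_lt_of_lt_one_left hpos (pow_lt_one₀ hs0.le hs1 two_ne_zero)

end NonhierGREM

theorem proposition4 {n : ℕ}
    (a : Finset (Fin n) → ℝ) (ha_nonneg : ∀ J, 0 ≤ a J) (ha_empty : a ∅ = 0)
    (ha_sum : ∑ J, a J = 1)
    (γ : Fin n → ℝ) (hγ_pos : ∀ i, 0 < γ i) (hγ_sum : ∑ i, γ i = 1)
    -- `m N i` is the number of values of the `i`-th spin, `2 ^ (γ i * N)` up to rounding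
    (m : ℕ → Fin n → ℕ) (hm_pos : ∀ N i, 0 < m N i)
    (hm : ∀ i, Tendsto (fun N : ℕ => Real.logb 2 (m N i) / (N : ℝ)) atTop (𝓝 (γ i)))
    {Ω : Type*} [MeasurableSpace Ω] (μ : Measure Ω) [IsProbabilityMeasure μ]
    (X : (N : ℕ) → (J : Active a) → LocalConfig (m N) J.1 → Ω → ℝ)
    (hX : ∀ N, IsDisorder a N (m N) μ (X N))
    (β : ℝ) (hβ : 0 ≤ β) :
    (∀ N, Integrable (fun ω => finiteFreeEnergy N β (hamiltonian (X N) ω)) μ) ∧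
    ∃ f : ℝ,
      Tendsto (fun N : ℕ => ∫ ω, finiteFreeEnergy N β (hamiltonian (X N) ω) ∂μ)
        atTop (𝓝 f) ∧
      IsLUB (psi a β '' deltaPlus a γ) f := by
  choose Y hY hYmeas hYX using fun N => (hX N).exists_measurable
  have hae : ∀ N, (fun ω => finiteFreeEnergy N β (hamiltonian (Y N) ω)) =ᵐ[μ]
      fun ω => finiteFreeEnergy N β (hamiltonian (X N) ω) := fun N => by
    filter_upwards [hYX N] with ω hω
    rw [hω]
  have hlub : IsLUB (psi a β '' deltaPlus a γ) (sSup (psi a β '' deltaPlus a γ)) := by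
    refine isLUB_csSup ⟨_, 0, zero_mem_deltaPlus hγ_pos, rfl⟩ ⟨β ^ 2 / 2, ?_⟩
    rintro _ ⟨l, _, rfl⟩
    exact psi_le (sum_active_eq_one ha_nonneg ha_sum) β l
  refine ⟨fun N => Integrable.congr (((hY N).integrable_log_partitionFunction (hm_pos N)
    (hYmeas N) β).const_mul _) (hae N), sSup (psi a β '' deltaPlus a γ), ?_, hlub⟩
  simp only [← fun N => integral_congr_ae (hae N)]
  refine tendsto_order.2 ⟨fun b hb => ?_, fun b hb => ?_⟩
  · obtain ⟨_, ⟨l, hl, rfl⟩, hlb⟩ := (lt_isLUB_iff hlub).1 hb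
    exact eventually_lt_integral_finiteFreeEnergy ha_empty hγ_pos hm_pos hm hY hYmeas hβ hl hlb
  · exact eventually_integral_finiteFreeEnergy_lt ha_nonneg ha_empty ha_sum hγ_pos hm_pos hm hY
      hYmeas hβ (fun l hl => hlub.1 ⟨l, hl, rfl⟩) hb
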